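/- Let $X$ be an infinite-dimensional complex Banach space and let $T$ be a bounded linear operator on $X$, with spectrum $\sigma(T)$ and approximate point spectrum $\sigma_a(T)$. Write $\mathcal N(S)$ and $\mathcal R(S)$ for the kernel and the range of an operator $S$. $S$ is Fredholm if $\mathcal R(S)$ is closed, $\dim \mathcal N(S)<\infty$ and $\operatorname{codim}\mathcal R(S)<\infty$. $S$ is B-Fredholm if for some $n\in\mathbb N$ the range $\mathcal R(S^n)$ is closed and the operator $\mathcal R(S^n)\to\mathcal R(S^n)$ induced by $S$ is Fredholm. The essential spectrum $\sigma_e(T)$ (resp. the B-Fredholm spectrum $\sigma_{bf}(T)$) is the set of $\lambda\in\mathbb C$ such that $T-\lambda I$ is not Fredholm (resp. not B-Fredholm); put $\Delta_e(T)=\sigma(T)\setminus\sigma_e(T)$ and $\Delta_e^g(T)=\sigma(T)\setminus\sigma_{bf}(T)$. The ascent of $S$ is $p(S)=\inf\{n\in\mathbb N:\mathcal N(S^n)=\mathcal N(S^{n+1})\}$, where $\mathbb N$ contains $0$ and $\inf\emptyset=\infty$. The set $\Pi_a(T)$ of left poles of $T$ consists of the $\lambda\in\sigma_a(T)$ such that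 $p=p(T-\lambda I)<\infty$ and $\mathcal R((T-\lambda I)^{p+1})$ is closed; $\Pi_a^0(T)$ is the set of left poles of finite rank, i.e. of those $\lambda\in\Pi_a(T)$ with $\dim\mathcal N(T-\lambda I)<\infty$. One says that $T\in(ab_e)$ if $\Delta_e(T)=\Pi_a^0(T)$, and that $T\in(gab_e)$ if $\Delta_e^g(T)=\Pi_a(T)$. **Proposition.** If $T\in(gab_e)$, then $T\in(ab_e)$. The inclusion $(gab_e)\subset(ab_e)$ can be proper: there is a bounded linear operator on the complex Hilbert space $\ell^2(\mathbb N)$ that belongs to $(ab_e)$ but not to $(gab_e)$. -/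

import Mathlib

namespace BFredholm

variable {X : Type*} [NormedAddCommGroup X] [NormedSpace ℂ X]

/-- The operator `T - μ I`. -/
def shift (T : X →L[ℂ] X) (μ : ℂ) : X →L[ℂ] X :=
  T - μ • ContinuousLinearMap.id ℂ X

/-- The ascent `p(T) = inf {n : N(T ^ n) = N(T ^ (n + 1))}`, equal to `⊤` if there is no such
`n`. -/
noncomputable def ascent (T : X →L[ℂ] X) : ℕ∞ :=
  ⨅ (n : ℕ) (_ : (T ^ n).ker = (T ^ (n + 1)).ker), (n : ℕ∞)

theorem mem_range_pow (T : X →L[ℂ] X) (n : ℕ) :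
    ∀ x ∈ (T ^ n).range, T x ∈ (T ^ n).range := by
  rintro x ⟨y, rfl⟩
  refine ⟨T y, ?_⟩
  change (T ^ n * T) y = (T * T ^ n) y
  rw [← pow_succ, ← pow_succ']

/-- The operator `T_[n] : R(T ^ n) → R(T ^ n)` induced by `T`. -/
def restrictRange (T : X →L[ℂ] X) (n : ℕ) : (T ^ n).range →L[ℂ] (T ^ n).range :=
  T.restrict (mem_range_pow T n)

/-- `T` is B-Fredholm: for some `n`, the range of `T ^ n` is closed and `T_[n]` is Fredholm. -/
def IsBFredholm (T : X →L[ℂ] X) : Prop :=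
  ∃ n : ℕ, IsClosed ((T ^ n).range : Set X) ∧ (restrictRange T n).IsFredholm

/-- The essential spectrum `σ_e(T)`. -/
def essSpectrum (T : X →L[ℂ] X) : Set ℂ :=
  {μ | ¬ (shift T μ).IsFredholm}

/-- The B-Fredholm spectrum `σ_bf(T)`. -/
def bFredholmSpectrum (T : X →L[ℂ] X) : Set ℂ :=
  {μ | ¬ IsBFredholm (shift T μ)}

/-- The approximate (point) spectrum `σ_a(T)`. -/
def approxSpectrum (T : X →L[ℂ] X) : Set ℂ :=
  {μ | ∀ ε : ℝ, 0 < ε → ∃ x : X, ‖x‖ = 1 ∧ ‖shift T μ x‖ < ε}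

/-- `Δ_e(T) = σ(T) \ σ_e(T)`. -/
def DeltaE (T : X →L[ℂ] X) : Set ℂ :=
  spectrum ℂ T \ essSpectrum T

/-- `Δ_e^g(T) = σ(T) \ σ_bf(T)`. -/
def DeltaEg (T : X →L[ℂ] X) : Set ℂ :=
  spectrum ℂ T \ bFredholmSpectrum T

/-- `Π_a(T)`: the left poles of `T`, that is, the `μ ∈ σ_a(T)` such that `p = p(T - μ I)` is finite
and the range of `(T - μ I) ^ (p + 1)` is closed. -/
def leftPoles (T : X →L[ℂ] X) : Set ℂ :=
  {μ | μ ∈ approxSpectrum T ∧ ∃ p : ℕ, ascent (shift T μ) = p ∧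
    IsClosed (((shift T μ) ^ (p + 1)).range : Set X)}

/-- `Π_a^0(T)`: the left poles `μ` of finite rank, that is, with `α(T - μ I) < ∞`. -/
def leftPolesFiniteRank (T : X →L[ℂ] X) : Set ℂ :=
  {μ | μ ∈ leftPoles T ∧ FiniteDimensional ℂ (shift T μ).ker}

/-- The class `(ab_e)`. -/
def IsABe (T : X →L[ℂ] X) : Prop :=
  DeltaE T = leftPolesFiniteRank T

/-- The class `(gab_e)`. -/
def IsGABe (T : X →L[ℂ] X) : Prop :=
  DeltaEg T = leftPoles T

end BFredholm

/-! ### Fredholm and B-Fredholm operators with finite-dimensional kernel -/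

namespace BFredholm

/-! For operators with finite-dimensional kernel, Fredholm and B-Fredholm coincide
(`isBFredholm_of_isFredholm`, `IsBFredholm.isFredholm`). Cutting `Δ_e^g(T) = Π_a(T)` down to the
points with finite-dimensional kernel therefore gives `Δ_e(T) = Π_a^0(T)`.

For properness, take `T = (0 ⊕ V) ⊗ 1` with `V` a unilateral shift. Infinite multiplicity makes
finite-dimensional kernels and cokernels of `T - μ` vanish, so `Δ_e(T)` and `Π_a^0(T)` are both
empty. Yet `0` is a left pole of ascent 1, and `T` is not B-Fredholm because the ranges of its
powers strictly decrease. -/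

theorem cofg_of_cofg_sup {K M : Type*} [Field K] [AddCommGroup M] [Module K M]
    {R N : Submodule K M} (h : (R ⊔ N).CoFG) (hN : N.FG) : R.CoFG := by
  have : Module.Finite K N := .of_fg hN
  refine ⟨Submodule.fg_of_fg_map_of_fg_inf_ker
    (Submodule.mapQ R (R ⊔ N) LinearMap.id le_sup_left) (IsNoetherian.noetherian _) ?_⟩
  refine (hN.map R.mkQ).of_le ?_
  rintro x ⟨-, hx⟩
  obtain ⟨x, rfl⟩ := Submodule.Quotient.mk_surjective _ x
  have hx' : x ∈ R ⊔ N := (Submodule.Quotient.mk_eq_zero _).1 hx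
  obtain ⟨r, hr, y, hy, rfl⟩ := Submodule.mem_sup.1 hx'
  refine ⟨y, hy, ?_⟩
  rw [Submodule.Quotient.mk_add, (Submodule.Quotient.mk_eq_zero _).2 hr, zero_add]
  rfl

section Banach

variable {X Y : Type*} [NormedAddCommGroup X] [NormedSpace ℂ X]
  [NormedAddCommGroup Y] [NormedSpace ℂ Y]

/-- Between Banach spaces, an operator with finite-dimensional kernel and cokernel is Fredholm. -/
theorem isFredholm_of_finite_ker_of_finite_coker [CompleteSpace X] [CompleteSpace Y]
    (S : X →L[ℂ] Y) (hker : FiniteDimensional ℂ S.ker) (hcoker : S.range.CoFG) :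
    S.IsFredholm := by
  obtain ⟨A, hA⟩ :=
    (Submodule.ClosedComplemented.of_finiteDimensional S.ker).exists_isTopCompl
  have hAcl : IsClosed (A : Set X) := hA.symm.isClosed
  have : CompleteSpace A := hAcl.completeSpace_coe
  have hinj : ∀ x ∈ A, S x = 0 → x = 0 := fun x hx h =>
    (Submodule.disjoint_def.1 hA.isCompl.disjoint) x h hx
  have hsurj : ∀ x, ∃ a ∈ A, S a = S x := fun x => by
    obtain ⟨k, hk, a, ha, rfl⟩ := Submodule.mem_sup.1
      (hA.isCompl.sup_eq_top ▸ Submodule.mem_top : x ∈ S.ker ⊔ A)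
    refine ⟨a, ha, ?_⟩
    have hk' : S k = 0 := hk
    rw [map_add, hk', zero_add]
  have hrange : (S.domRestrict A).range = S.range := by
    ext y
    constructor
    · rintro ⟨a, rfl⟩
      exact ⟨a, rfl⟩
    · rintro ⟨x, rfl⟩
      obtain ⟨a, ha, h⟩ := hsurj x
      exact ⟨⟨a, ha⟩, h⟩
  have hkerA : (S.domRestrict A).ker = ⊥ :=
    (Submodule.eq_bot_iff _).2 fun x hx => Subtype.ext (hinj x x.2 hx)
  -- An algebraic complement of the range is finite-dimensional, hence closed, and this forces the
  -- range itself to be closed.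
  obtain ⟨C, hC⟩ := S.range.exists_isCompl
  have : FiniteDimensional ℂ C := .of_fg (hcoker.fg_of_isCompl hC)
  have hRcl : IsClosed (S.range : Set Y) := by
    rw [← hrange]
    exact ContinuousLinearMap.closed_complemented_range_of_isCompl_of_ker_eq_bot
      (S.domRestrict A) C (hrange ▸ hC) C.closed_of_finiteDimensional hkerA
  have : CompleteSpace S.range := hRcl.completeSpace_coe
  have hA' : A.CoFG := (Submodule.fg_iff_finiteDimensional S.ker).2 hker |>.cofg_of_isCompl hA.isCompl
  refine .of_isInvertible_restrict (E₁ := A) (F₁ := S.range) hAcl hRcl (fun x _ => ⟨x, rfl⟩) ?_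
  refine ⟨ContinuousLinearEquiv.ofBijective _ ?_ ?_, ContinuousLinearEquiv.coe_ofBijective _ _ _⟩
  · exact (Submodule.eq_bot_iff _).2 fun x hx =>
      Subtype.ext (hinj x x.2 (congrArg Subtype.val hx))
  · refine LinearMap.range_eq_top.2 ?_
    rintro ⟨_, x, rfl⟩
    obtain ⟨a, ha, h⟩ := hsurj x
    exact ⟨⟨a, ha⟩, Subtype.ext h⟩

theorem isBFredholm_of_isFredholm [CompleteSpace X] {S : X →L[ℂ] X} (hS : S.IsFredholm) :
    IsBFredholm S := by
  have htop : (S ^ 0).range = ⊤ := LinearMap.range_eq_top.2 fun x => ⟨x, rfl⟩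
  have hcl : IsClosed ((S ^ 0).range : Set X) := by
    rw [htop]
    exact isClosed_univ
  have : CompleteSpace (S ^ 0).range := hcl.completeSpace_coe
  have := hS.finite_ker
  have := hS.finite_coker
  refine ⟨0, hcl, isFredholm_of_finite_ker_of_finite_coker _ ?_ ?_⟩
  · refine Module.Finite.of_injective
      (((S ^ 0).range.subtype.comp (restrictRange S 0).ker.subtype).codRestrict S.ker
        fun x => congrArg Subtype.val x.2) fun x y h => ?_
    exact Subtype.ext (Subtype.ext (congrArg (fun z : S.ker => (z : X)) h))
  · refine Module.Finite.of_surjective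
      (Submodule.mapQ S.range (restrictRange S 0).range
        (S ^ 0).toLinearMap.rangeRestrict ?_) ?_
    · rintro _ ⟨x, rfl⟩
      exact ⟨⟨x, x, rfl⟩, rfl⟩
    · intro q
      obtain ⟨⟨_, x, rfl⟩, rfl⟩ := Submodule.Quotient.mk_surjective _ q
      exact ⟨Submodule.Quotient.mk x, rfl⟩

theorem finiteDimensional_ker_pow {S : X →L[ℂ] X} (hS : FiniteDimensional ℂ S.ker) (n : ℕ) :
    FiniteDimensional ℂ (S ^ n).ker := by
  induction n with
  | zero =>
    have : (S ^ 0).ker = ⊥ := (Submodule.eq_bot_iff _).2 fun x hx => hx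
    rw [this]
    infer_instance
  | succ n ih =>
    have : (S ^ (n + 1)).ker = Submodule.comap S.toLinearMap (S ^ n).ker := by
      ext x
      rw [pow_succ]
      rfl
    rw [this]
    infer_instance

/-- If `S ^ n x = S ^ (n + 1) y`, then `x - S y ∈ N(S ^ n)`. So `R(S) + N(S ^ n)` has finite
codimension, and its second summand is finite-dimensional. -/
theorem IsBFredholm.isFredholm [CompleteSpace X] {S : X →L[ℂ] X} (hS : IsBFredholm S)
    (hker : FiniteDimensional ℂ S.ker) : S.IsFredholm := by
  obtain ⟨n, -, hF⟩ := hS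
  refine isFredholm_of_finite_ker_of_finite_coker S hker ?_
  have := hF.finite_coker
  have := finiteDimensional_ker_pow hker n
  let q : X →ₗ[ℂ] (S ^ n).range ⧸ (restrictRange S n).range :=
    (Submodule.mkQ _).comp (S ^ n).toLinearMap.rangeRestrict
  have hq : LinearMap.ker q ≤ S.range ⊔ (S ^ n).ker := by
    intro x hx
    obtain ⟨⟨_, y, rfl⟩, hy⟩ := (Submodule.Quotient.mk_eq_zero _).1 hx
    have hy' : S ((S ^ n) y) = (S ^ n) x := congrArg Subtype.val hy
    refine Submodule.mem_sup.2 ⟨S y, ⟨y, rfl⟩, x - S y, ?_, by abel⟩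
    change (S ^ n) (x - S y) = 0
    have : (S ^ n) (S y) = S ((S ^ n) y) := by
      change (S ^ n * S) y = (S * S ^ n) y
      rw [← pow_succ, ← pow_succ']
    rw [map_sub, this, hy', sub_self]
  exact cofg_of_cofg_sup ((Submodule.CoFG.ker q).of_le hq)
    ((Submodule.fg_iff_finiteDimensional _).2 this)

theorem IsGABe.isABe [CompleteSpace X] {T : X →L[ℂ] X} (hT : IsGABe T) : IsABe T := by
  ext μ
  constructor
  · rintro ⟨hσ, hμ⟩
    have hF : (shift T μ).IsFredholm := not_not.1 hμ
    refine ⟨?_, hF.finite_ker⟩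
    rw [← (hT : DeltaEg T = leftPoles T)]
    exact ⟨hσ, not_not.2 (isBFredholm_of_isFredholm hF)⟩
  · rintro ⟨hμ, hker⟩
    rw [← (hT : DeltaEg T = leftPoles T)] at hμ
    exact ⟨hμ.1, not_not.2 ((not_not.1 hμ.2).isFredholm hker)⟩

end Banach

end BFredholm

namespace BFredholm

/-! ### Infinite multiplicity: finite defects vanish -/

section CuntzCommutant

variable {K E : Type*} [Field K] [AddCommGroup E] [Module K E]

/-- `S` commutes with two injections `J a` with left inverses `Q a` whose ranges are independent;
this happens for `S = A ⊗ 1` on a tensor product with an infinite-dimensional space. -/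
structure IsAmpliation (S : E →ₗ[K] E) (J Q : Fin 2 → E →ₗ[K] E) : Prop where
  commJ : ∀ a x, J a (S x) = S (J a x)
  commQ : ∀ a x, Q a (S x) = S (Q a x)
  QJ_self : ∀ a x, Q a (J a x) = x
  QJ_zero_one : ∀ x, Q 0 (J 1 x) = 0

namespace IsAmpliation

variable {S : E →ₗ[K] E} {J Q : Fin 2 → E →ₗ[K] E}

/-- The maps `J a` embed two copies of the kernel into itself, so its dimension `d` satisfies `2 * d
≤ d`. Dually, the `Q a` map the cokernel onto two copies of itself. -/
theorem ker_eq_bot (h : IsAmpliation S J Q) (hfin : FiniteDimensional K (LinearMap.ker S)) :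
    LinearMap.ker S = ⊥ := by
  have hmem : ∀ a, ∀ x ∈ LinearMap.ker S, J a x ∈ LinearMap.ker S := fun a x hx => by
    rw [LinearMap.mem_ker, ← h.commJ, LinearMap.mem_ker.1 hx, map_zero]
  let F : (LinearMap.ker S × LinearMap.ker S) →ₗ[K] LinearMap.ker S :=
    ((J 0).restrict (hmem 0)).coprod ((J 1).restrict (hmem 1))
  have hF : Function.Injective F := by
    refine LinearMap.ker_eq_bot.1 ((Submodule.eq_bot_iff _).2 ?_)
    rintro ⟨x, y⟩ hxy
    have h1 : J 0 (x : E) + J 1 (y : E) = 0 := congrArg Subtype.val hxy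
    have hx : (x : E) = 0 := by
      have := congrArg (Q 0) h1
      rwa [map_add, h.QJ_self, h.QJ_zero_one, add_zero, map_zero] at this
    have hy : (y : E) = 0 := by
      have := congrArg (Q 1) h1
      rwa [hx, map_zero, zero_add, h.QJ_self, map_zero] at this
    exact Prod.ext (Subtype.ext hx) (Subtype.ext hy)
  have hle := LinearMap.finrank_le_finrank_of_injective hF
  rw [Module.finrank_prod] at hle
  exact Submodule.finrank_eq_zero.1 (by omega)

theorem range_eq_top (h : IsAmpliation S J Q) (hfin : (LinearMap.range S).CoFG) :
    LinearMap.range S = ⊤ := by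
  have hmem : ∀ a, LinearMap.range S ≤ (LinearMap.range S).comap (Q a) := by
    rintro a _ ⟨x, rfl⟩
    exact ⟨Q a x, (h.commQ a x).symm⟩
  let F : (E ⧸ LinearMap.range S) →ₗ[K] (E ⧸ LinearMap.range S) × (E ⧸ LinearMap.range S) :=
    (Submodule.mapQ _ _ (Q 0) (hmem 0)).prod (Submodule.mapQ _ _ (Q 1) (hmem 1))
  have hF : Function.Surjective F := by
    rintro ⟨x, y⟩
    obtain ⟨x, rfl⟩ := Submodule.Quotient.mk_surjective _ x
    obtain ⟨y, rfl⟩ := Submodule.Quotient.mk_surjective _ y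
    -- Only `Q 0 ∘ J 1 = 0` is assumed, so the second component is corrected by `Q 1 (J 0 x)`.
    refine ⟨Submodule.Quotient.mk (J 0 x + J 1 (y - Q 1 (J 0 x))), Prod.ext ?_ ?_⟩
    · change Submodule.Quotient.mk (Q 0 _) = Submodule.Quotient.mk x
      rw [map_add, h.QJ_self, h.QJ_zero_one, add_zero]
    · change Submodule.Quotient.mk (Q 1 _) = Submodule.Quotient.mk y
      rw [map_add, h.QJ_self, add_sub_cancel]
  have hle := LinearMap.finrank_le_finrank_of_surjective hF
  rw [Module.finrank_prod] at hle
  have hzero : Module.finrank K (E ⧸ LinearMap.range S) = 0 := by omega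
  exact Submodule.Quotient.subsingleton_iff.1 (Module.finrank_zero_iff.1 hzero)

end IsAmpliation

end CuntzCommutant

/-! ### Operators of infinite multiplicity belong to `(ab_e)` -/

section Ampliation

variable {X : Type*} [NormedAddCommGroup X] [NormedSpace ℂ X]
  {T : X →L[ℂ] X} {J Q : Fin 2 → X →ₗ[ℂ] X}

theorem IsAmpliation.shift (h : IsAmpliation T.toLinearMap J Q) (μ : ℂ) :
    IsAmpliation (shift T μ).toLinearMap J Q where
  commJ a x := by
    change J a (T x - μ • x) = T (J a x) - μ • J a x
    rw [map_sub, map_smul]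
    exact congrArg (· - _) (h.commJ a x)
  commQ a x := by
    change Q a (T x - μ • x) = T (Q a x) - μ • Q a x
    rw [map_sub, map_smul]
    exact congrArg (· - _) (h.commQ a x)
  QJ_self := h.QJ_self
  QJ_zero_one := h.QJ_zero_one

theorem mem_range_pow_of_comm {A : X →ₗ[ℂ] X} (hA : ∀ x, A (T x) = T (A x)) (n : ℕ) :
    ∀ x ∈ (T ^ n).range, A x ∈ (T ^ n).range := by
  rintro _ ⟨x, rfl⟩
  refine ⟨A x, ?_⟩
  induction n generalizing x with
  | zero => rfl
  | succ n ih =>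
    change (T ^ (n + 1)) (A x) = A ((T ^ (n + 1)) x)
    rw [pow_succ]
    change (T ^ n) (T (A x)) = A ((T ^ n) (T x))
    rw [← hA]
    exact ih (T x)

theorem IsAmpliation.restrictRange (h : IsAmpliation T.toLinearMap J Q) (n : ℕ) :
    IsAmpliation (restrictRange T n).toLinearMap
      (fun a => (J a).restrict (mem_range_pow_of_comm (h.commJ a) n))
      (fun a => (Q a).restrict (mem_range_pow_of_comm (h.commQ a) n)) where
  commJ a x := Subtype.ext (h.commJ a x)
  commQ a x := Subtype.ext (h.commQ a x)
  QJ_self a x := Subtype.ext (h.QJ_self a x)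
  QJ_zero_one x := Subtype.ext (h.QJ_zero_one x)

variable [CompleteSpace X]

theorem IsAmpliation.deltaE_eq_empty (h : IsAmpliation T.toLinearMap J Q) : DeltaE T = ∅ := by
  refine Set.eq_empty_of_forall_notMem ?_
  rintro μ ⟨hσ, hμ⟩
  have hF : (BFredholm.shift T μ).IsFredholm := not_not.1 hμ
  have hu : IsUnit (BFredholm.shift T μ) := ContinuousLinearMap.isUnit_iff_bijective.2
    ⟨LinearMap.ker_eq_bot.1 ((h.shift μ).ker_eq_bot hF.finite_ker),
      LinearMap.range_eq_top.1 ((h.shift μ).range_eq_top hF.finite_coker)⟩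
  refine hσ ?_
  have heq : algebraMap ℂ (X →L[ℂ] X) μ - T = -BFredholm.shift T μ := by
    rw [BFredholm.shift, neg_sub]
    rfl
  change IsUnit (algebraMap ℂ (X →L[ℂ] X) μ - T)
  rw [heq]
  exact hu.neg

/-- At such a pole `T - μ` is injective, so the ascent is 0 and its range is closed. It is then
bounded below, contradicting `μ ∈ σ_a(T)`. -/
theorem IsAmpliation.leftPolesFiniteRank_eq_empty (h : IsAmpliation T.toLinearMap J Q) :
    leftPolesFiniteRank T = ∅ := by
  refine Set.eq_empty_of_forall_notMem ?_
  rintro μ ⟨⟨hσ, p, hp, hcl⟩, hfin⟩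
  have hker := (h.shift μ).ker_eq_bot hfin
  have hasc : ascent (BFredholm.shift T μ) ≤ 0 := by
    refine iInf₂_le_of_le 0 ?_ le_rfl
    rw [zero_add, pow_one]
    refine Eq.trans ?_ hker.symm
    exact (Submodule.eq_bot_iff _).2 fun x hx => hx
  obtain rfl : p = 0 := by
    rw [hp] at hasc
    exact_mod_cast le_antisymm hasc (zero_le)
  rw [zero_add, pow_one] at hcl
  obtain ⟨c, hc⟩ := (BFredholm.shift T μ).antilipschitz_of_injective_of_isClosed_range
    (LinearMap.ker_eq_bot.1 hker) hcl
  obtain ⟨x, hx, hlt⟩ := hσ (1 / (c + 1)) (by positivity)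
  have hb := hc.le_mul_norm (map_zero _) x
  rw [hx] at hb
  rw [lt_div_iff₀ (by positivity)] at hlt
  nlinarith [norm_nonneg (BFredholm.shift T μ x), c.coe_nonneg]

theorem IsAmpliation.isABe (h : IsAmpliation T.toLinearMap J Q) : IsABe T :=
  h.deltaE_eq_empty.trans h.leftPolesFiniteRank_eq_empty.symm

end Ampliation

end BFredholm

namespace BFredholm

/-! ### Left poles and B-Fredholmness from a generalized inverse -/

section PartialIsometry

variable {X : Type*} [NormedAddCommGroup X] [NormedSpace ℂ X] {T T' : X →L[ℂ] X}

theorem zero_mem_leftPoles (h₁ : ∀ x, T' (T (T x)) = T x) (h₂ : ∀ x, T (T' (T x)) = T x)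
    {x : X} (hx : ‖x‖ = 1) (hTx : T x = 0) : 0 ∈ leftPoles T := by
  have hs : shift T 0 = T := by rw [shift, zero_smul, sub_zero]
  refine ⟨fun ε hε => ⟨x, hx, by rwa [hs, hTx, norm_zero]⟩, 1, ?_, ?_⟩
  · rw [hs]
    refine le_antisymm (iInf₂_le 1 ?_) (le_iInf₂ fun n hn => ?_)
    · ext y
      rw [one_add_one_eq_two, pow_one, pow_two]
      refine ⟨fun hy => ?_, fun hy => ?_⟩
      · change T (T y) = 0
        rw [show T y = 0 from hy, map_zero]
      · change T y = 0
        rw [← h₁, show T (T y) = 0 from hy, map_zero]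
    · rcases n with _ | n
      · rw [zero_add, pow_one] at hn
        have hx0 : x ∈ (T ^ 0).ker := hn ▸ hTx
        rw [show x = 0 from hx0, norm_zero] at hx
        exact absurd hx zero_ne_one
      · exact_mod_cast Nat.succ_le_succ (Nat.zero_le n)
  · rw [hs]
    -- `T² T'²` is a continuous map fixing exactly `R(T²)`, which is therefore closed.
    have : ((T ^ (1 + 1)).range : Set X) = {y | T (T (T' (T' y))) = y} := by
      ext y
      constructor
      · rintro ⟨z, rfl⟩
        change T (T (T' (T' (T (T z))))) = T (T z)
        rw [h₁, h₂]
      · intro hy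
        exact ⟨T' (T' y), hy⟩
    rw [this]
    exact isClosed_eq (by fun_prop) continuous_id

theorem pow_apply_pow_succ (h₁ : ∀ x, T' (T (T x)) = T x) (n : ℕ) (x : X) :
    (T' ^ n) ((T ^ (n + 1)) x) = T x := by
  induction n with
  | zero => rw [zero_add, pow_one]; rfl
  | succ n ih =>
    have : (T ^ (n + 1 + 1)) x = T (T ((T ^ n) x)) := by
      rw [pow_succ', pow_succ']; rfl
    rw [this, pow_succ]
    change (T' ^ n) (T' (T (T ((T ^ n) x)))) = T x
    rw [h₁, ← ih, pow_succ']
    rfl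

/-- Applying `T' ^ n` to `T ^ (n + 1) z = T ^ n e` would give `T z = e`. -/
theorem range_pow_succ_ne (h₁ : ∀ x, T' (T (T x)) = T x) {e : X} (he : T' (T e) = e)
    (he' : ∀ z, T z ≠ e) (n : ℕ) : ∃ x, ∀ z, (T ^ (n + 1)) z ≠ (T ^ n) x := by
  have hpow : ∀ n : ℕ, (T' ^ n) ((T ^ n) e) = e := by
    intro n
    rcases n with _ | n
    · rfl
    · rw [pow_succ']
      change T' ((T' ^ n) ((T ^ (n + 1)) e)) = e
      rw [pow_apply_pow_succ h₁, he]
  refine ⟨e, fun z hz => he' z ?_⟩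
  rw [← pow_apply_pow_succ h₁ n z, hz, hpow]

/-- Each `T_[n]` inherits the infinite multiplicity, so if Fredholm it would be onto, contradicting
the strict decrease of ranges. -/
theorem IsAmpliation.not_isBFredholm {J Q : Fin 2 → X →ₗ[ℂ] X}
    (h : IsAmpliation T.toLinearMap J Q) (h₁ : ∀ x, T' (T (T x)) = T x)
    {e : X} (he : T' (T e) = e) (he' : ∀ z, T z ≠ e) : ¬ IsBFredholm T := by
  rintro ⟨n, -, hF⟩
  obtain ⟨x, hx⟩ := range_pow_succ_ne h₁ he he' n
  have htop := (h.restrictRange n).range_eq_top hF.finite_coker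
  obtain ⟨⟨_, z, rfl⟩, hz⟩ := LinearMap.range_eq_top.1 htop ⟨(T ^ n) x, x, rfl⟩
  refine hx z ?_
  rw [pow_succ']
  exact congrArg Subtype.val hz

end PartialIsometry

/-! ### The counterexample on `ℓ²(ℕ)` -/

section SequenceSpace

/-- The sequence space `ℓ²(ℕ)`. -/
abbrev L2 : Type := lp (fun _ : ℕ => ℂ) 2

theorem sum_partialComp_le {f : ℕ → Option ℕ}
    (hf : ∀ a b c, f a = some c → f b = some c → a = b) (x : L2) (s : Finset ℕ) :
    ∑ i ∈ s, ‖(f i).elim 0 x‖ ^ (2 : ENNReal).toReal ≤ ‖x‖ ^ (2 : ENNReal).toReal := by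
  have h2 : 0 < (2 : ENNReal).toReal := by norm_num
  classical
  have hinj : Set.InjOn (fun i => (f i).getD 0) (s.filter fun i => (f i).isSome : Finset ℕ) := by
    intro a ha b hb hab
    obtain ⟨c, hc⟩ := Option.isSome_iff_exists.1 (Finset.mem_filter.1 ha).2
    obtain ⟨d, hd⟩ := Option.isSome_iff_exists.1 (Finset.mem_filter.1 hb).2
    have hcd : c = d := by simpa [hc, hd] using hab
    exact hf a b c hc (hcd ▸ hd)
  refine le_of_eq_of_le ?_ (lp.sum_rpow_le_norm_rpow h2 x
    ((s.filter fun i => (f i).isSome).image fun i => (f i).getD 0))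
  rw [Finset.sum_image hinj, Finset.sum_filter]
  refine Finset.sum_congr rfl fun i _ => ?_
  cases h : f i <;> simp

/-- Composition with a partial injection `f` of `ℕ`: `(x n) ↦ (x (f n))`, with the value `0` where
`f` is undefined. -/
noncomputable def partialComp (f : ℕ → Option ℕ)
    (hf : ∀ a b c, f a = some c → f b = some c → a = b) : L2 →L[ℂ] L2 :=
  LinearMap.mkContinuous
    { toFun := fun x => ⟨fun n => (f n).elim 0 x, memℓp_gen' (sum_partialComp_le hf x)⟩
      map_add' := fun x y => by
        refine lp.ext (funext fun n => ?_)
        change (f n).elim 0 ⇑(x + y) = (f n).elim 0 x + (f n).elim 0 y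
        cases f n
        · exact (add_zero 0).symm
        · rfl
      map_smul' := fun c x => by
        refine lp.ext (funext fun n => ?_)
        change (f n).elim 0 ⇑(c • x) = c • (f n).elim 0 x
        cases f n
        · exact (smul_zero c).symm
        · rfl } 1
    fun x => by
      rw [one_mul]
      exact lp.norm_le_of_forall_sum_le (by norm_num) (norm_nonneg x) (sum_partialComp_le hf x)

/-- The entries of a sequence, indexed by pairs. -/
def entry (x : L2) (p : ℕ × ℕ) : ℂ := x (Nat.pair p.1 p.2)

theorem ext_entry {x y : L2} (h : ∀ p, entry x p = entry y p) : x = y := by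
  refine lp.ext (funext fun n => ?_)
  have := h (Nat.unpair n)
  rwa [entry, entry, Nat.pair_unpair] at this

/-- Composition with a partial injection of `ℕ × ℕ`. -/
noncomputable def pairComp (φ : ℕ × ℕ → Option (ℕ × ℕ))
    (hφ : ∀ a b c, φ a = some c → φ b = some c → a = b) : L2 →L[ℂ] L2 :=
  partialComp (fun n => (φ (Nat.unpair n)).map fun p => Nat.pair p.1 p.2) fun a b c ha hb => by
    obtain ⟨p, hp, hpc⟩ := Option.map_eq_some_iff.1 ha
    obtain ⟨q, hq, hqc⟩ := Option.map_eq_some_iff.1 hb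
    obtain ⟨h1, h2⟩ := Nat.pair_eq_pair.1 (hpc.trans hqc.symm)
    obtain rfl : p = q := Prod.ext h1 h2
    exact Nat.pairEquiv.symm.injective (hφ _ _ _ hp hq)

theorem entry_pairComp (φ : ℕ × ℕ → Option (ℕ × ℕ))
    (hφ : ∀ a b c, φ a = some c → φ b = some c → a = b) (x : L2) (p : ℕ × ℕ) :
    entry (pairComp φ hφ x) p = (φ p).elim 0 (entry x) := by
  change ((φ (Nat.unpair (Nat.pair p.1 p.2))).map fun p => Nat.pair p.1 p.2).elim 0 x = _
  rw [Nat.unpair_pair]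
  cases φ p <;> rfl

/-- The operator `0 ⊕ V` with `V` a unilateral shift, taken with infinite multiplicity:
`(x (i, j)) ↦ (x (i - 1, j))` for `i ≥ 2`, and `0` for `i ≤ 1`. -/
noncomputable def truncShift : L2 →L[ℂ] L2 :=
  pairComp (fun p => if 2 ≤ p.1 then some (p.1 - 1, p.2) else none) <| by
    rintro ⟨a, b⟩ ⟨c, d⟩ ⟨u, v⟩
    grind

/-- The adjoint of `truncShift`. -/
noncomputable def truncBackShift : L2 →L[ℂ] L2 :=
  pairComp (fun p => if 1 ≤ p.1 then some (p.1 + 1, p.2) else none) <| by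
    rintro ⟨a, b⟩ ⟨c, d⟩ ⟨u, v⟩
    grind

/-- Spreads a sequence over the second indices congruent to `a` modulo two. -/
noncomputable def spread (a : Fin 2) : L2 →L[ℂ] L2 :=
  pairComp (fun p => if p.2 % 2 = a then some (p.1, p.2 / 2) else none) <| by
    rintro ⟨a, b⟩ ⟨c, d⟩ ⟨u, v⟩
    grind

/-- Keeps the entries whose second index is congruent to `a` modulo two. -/
noncomputable def collect (a : Fin 2) : L2 →L[ℂ] L2 :=
  pairComp (fun p => some (p.1, 2 * p.2 + a)) <| by
    rintro ⟨a, b⟩ ⟨c, d⟩ ⟨u, v⟩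
    grind

theorem isAmpliation_truncShift : IsAmpliation truncShift.toLinearMap
    (fun a => (spread a).toLinearMap) (fun a => (collect a).toLinearMap) where
  commJ a x := by
    refine ext_entry fun ⟨i, j⟩ => ?_
    change entry (spread a (truncShift x)) (i, j) = entry (truncShift (spread a x)) (i, j)
    simp only [spread, truncShift, entry_pairComp]
    by_cases hj : j % 2 = a <;> by_cases hi : 2 ≤ i <;> simp [entry_pairComp, hi, hj]
  commQ a x := by
    refine ext_entry fun ⟨i, j⟩ => ?_
    change entry (collect a (truncShift x)) (i, j) = entry (truncShift (collect a x)) (i, j)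
    simp only [collect, truncShift, entry_pairComp]
    by_cases hi : 2 ≤ i <;> simp [entry_pairComp, hi]
  QJ_self a x := by
    refine ext_entry fun ⟨i, j⟩ => ?_
    change entry (collect a (spread a x)) (i, j) = entry x (i, j)
    have h1 : (2 * j + (a : ℕ)) % 2 = a := by omega
    have h2 : (2 * j + (a : ℕ)) / 2 = j := by omega
    simp [collect, spread, entry_pairComp, h1, h2]
  QJ_zero_one x := by
    refine ext_entry fun ⟨i, j⟩ => ?_
    change entry (collect 0 (spread 1 x)) (i, j) = 0
    simp [collect, spread, entry_pairComp]

theorem truncBackShift_truncShift_truncShift (x : L2) :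
    truncBackShift (truncShift (truncShift x)) = truncShift x := by
  refine ext_entry fun ⟨i, j⟩ => ?_
  simp only [truncBackShift, truncShift, entry_pairComp]
  rcases i with _ | _ | i <;> simp [entry_pairComp]

theorem truncShift_truncBackShift_truncShift (x : L2) :
    truncShift (truncBackShift (truncShift x)) = truncShift x := by
  refine ext_entry fun ⟨i, j⟩ => ?_
  simp only [truncBackShift, truncShift, entry_pairComp]
  rcases i with _ | _ | i <;> simp [entry_pairComp]

/-- The sequence whose only non-zero entry is a `1` at `p`. -/
noncomputable def unitVec (p : ℕ × ℕ) : L2 := lp.single 2 (Nat.pair p.1 p.2) 1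

theorem norm_unitVec (p : ℕ × ℕ) : ‖unitVec p‖ = 1 := by
  rw [unitVec, lp.norm_single (by norm_num), norm_one]

theorem entry_unitVec (p q : ℕ × ℕ) :
    entry (unitVec p) q = if q = p then 1 else 0 := by
  rw [entry, unitVec, lp.single_apply, Pi.single_apply]
  refine if_congr ?_ rfl rfl
  rw [Nat.pair_eq_pair, Prod.ext_iff]

theorem isABe_truncShift : IsABe truncShift :=
  isAmpliation_truncShift.isABe

theorem not_isGABe_truncShift : ¬ IsGABe truncShift := by
  intro h
  have h0 : (0 : ℂ) ∈ leftPoles truncShift := by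
    refine zero_mem_leftPoles truncBackShift_truncShift_truncShift
      truncShift_truncBackShift_truncShift
      (norm_unitVec (0, 0)) ?_
    · refine ext_entry fun ⟨i, j⟩ => ?_
      rw [truncShift, entry_pairComp]
      change _ = (0 : ℂ)
      by_cases hi : 2 ≤ i
      · have : i - 1 ≠ 0 := by omega
        simp [hi, entry_unitVec, this]
      · simp [hi]
  rw [← (h : DeltaEg truncShift = leftPoles truncShift)] at h0
  have hB : IsBFredholm (shift truncShift 0) := not_not.1 h0.2
  rw [shift, zero_smul, sub_zero] at hB
  -- The vector at `(1, 0)` starts the shift `V`: it is not killed, but every vector in the range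
  -- vanishes at first index 1.
  refine isAmpliation_truncShift.not_isBFredholm truncBackShift_truncShift_truncShift
    (e := unitVec (1, 0)) ?_ ?_ hB
  · refine ext_entry fun ⟨i, j⟩ => ?_
    rw [truncBackShift, truncShift, entry_pairComp]
    rcases i with _ | i <;> simp [entry_pairComp, entry_unitVec]
  · intro z hz
    have := congrArg (fun y => entry y (1, 0)) hz
    simp [truncShift, entry_pairComp, entry_unitVec] at this

end SequenceSpace

end BFredholm

theorem mainTheorem10 :
    (∀ (X : Type*) [NormedAddCommGroup X] [NormedSpace ℂ X] [CompleteSpace X],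
      ¬ FiniteDimensional ℂ X →
        ∀ T : X →L[ℂ] X, BFredholm.IsGABe T → BFredholm.IsABe T) ∧
    (∃ T : lp (fun _ : ℕ => ℂ) 2 →L[ℂ] lp (fun _ : ℕ => ℂ) 2,
      BFredholm.IsABe T ∧ ¬ BFredholm.IsGABe T) := by
  refine ⟨?_, BFredholm.truncShift, BFredholm.isABe_truncShift, BFredholm.not_isGABe_truncShift⟩
  intro X _ _ _ _ T hT
  exact hT.isABe
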